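/- Let $k$ be a field, $n\ge 0$ and $S=k[x_1,\dots,x_n]$ with its $\mathbb N^n$-grading. An $\mathbb N^n$-graded $S$-module is a module $M=\bigoplus_{a\in\mathbb N^n}M_a$ with $S_aM_b\subseteq M_{a+b}$. A finitely generated $\mathbb N^n$-graded $S$-module $M$ is called squarefree if multiplication by $x_i$ is a bijection $M_a\to M_{a+e_i}$ for every $a\in\mathbb N^n$ and every $i$ with $a_i\neq 0$; it is generated in degree zero if it is generated by $M_0$ as an $S$-module. Its fine Hilbert function is $a\mapsto\dim_k M_a$, and its Hilbert function is $H_M(i)=\dim_k\bigoplus_{|a|=i}M_a$ for $i\in\mathbb N$, where $|a|=a_1+\dots+a_n$. For a simplicial complex $\Delta$ on $\{1,\dots,n\}$ (a family of subsets that contains $\emptyset$ and is closed under taking subsets; singletons need not be faces), the Stanley–Reisner ring is $k[\Delta]=S/I_\Delta$, where $I_\Delta$ is generated by the monomials $\prod_{i\in F}x_i$ with $F\subseteq\{1,\dots,n\}$, $F\notin\Delta$. Then: 1. For every squarefree $S$-module $M$ generated in degree zero there are $r\ge 0$ and simplicial complexes $\Delta_1,\dots,\Delta_r$ on $\{1,\dots,n\}$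 such that $M$ and $k[\Delta_1]\oplus\dots\oplus k[\Delta_r]$ have the same fine Hilbert function and the same Hilbert function. 2. The cone of Hilbert functions of squarefree $S$-modules generated in degree zero is equal to the cone of Hilbert functions of Stanley–Reisner rings over $S$; that is, the sets $\{H_M : M \text{ squarefree, generated in degree zero}\}$ and $\{H_{k[\Delta]} : \Delta \text{ a simplicial complex on }\{1,\dots,n\}\}$ span the same convex cone (finite linear combinations with non-negative real coefficients) in $\mathbb R^{\mathbb N}$. -/

import Mathlib

universe u

noncomputable section

namespace SquarefreeCone

open MvPolynomial

/-- The component `S_a = k · x^a` of degree `a ∈ ℕⁿ` of `S = k[x_1, …, x_n]`. -/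
def polyGrading (k : Type*) [Field k] (n : ℕ) (a : Fin n →₀ ℕ) :
    Submodule k (MvPolynomial (Fin n) k) :=
  LinearMap.range (monomial (R := k) a)

/-- The family `𝓜` of `k`-subspaces makes the `S`-module `M` an `ℕⁿ`-graded `S`-module:
`M = ⨁ M_a` and `S_a M_b ⊆ M_{a+b}`. -/
structure IsGraded {k M : Type*} [Field k] {n : ℕ} [AddCommGroup M] [Module k M]
    [Module (MvPolynomial (Fin n) k) M] (𝓜 : (Fin n →₀ ℕ) → Submodule k M) : Prop where
  isInternal : DirectSum.IsInternal 𝓜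
  smul_mem : ∀ (a b : Fin n →₀ ℕ), ∀ p ∈ polyGrading k n a, ∀ m ∈ 𝓜 b, p • m ∈ 𝓜 (a + b)

/-- A squarefree module: a finitely generated `ℕⁿ`-graded `S`-module such that multiplication
by `x_i` is a bijection `M_a → M_{a+e_i}` for every `a` and every `i ∈ supp a`. -/
structure IsSquarefree {k M : Type*} [Field k] {n : ℕ} [AddCommGroup M] [Module k M]
    [Module (MvPolynomial (Fin n) k) M] (𝓜 : (Fin n →₀ ℕ) → Submodule k M) : Prop
    extends IsGraded 𝓜 where
  finite : Module.Finite (MvPolynomial (Fin n) k) M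
  bijOn : ∀ (a : Fin n →₀ ℕ), ∀ i ∈ a.support,
    Set.BijOn (fun m : M => (X i : MvPolynomial (Fin n) k) • m)
      (𝓜 a) (𝓜 (a + Finsupp.single i 1))

/-- `M` is generated, as an `S`-module, by its component of degree zero. -/
def GeneratedInDegreeZero {k M : Type*} [Field k] {n : ℕ} [AddCommGroup M] [Module k M]
    [Module (MvPolynomial (Fin n) k) M] (𝓜 : (Fin n →₀ ℕ) → Submodule k M) : Prop :=
  Submodule.span (MvPolynomial (Fin n) k) (𝓜 0 : Set M) = ⊤

/-- The fine Hilbert function `a ↦ dim_k M_a`. -/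
def fineHilbert {k M : Type*} [Field k] {n : ℕ} [AddCommGroup M] [Module k M]
    (𝓜 : (Fin n →₀ ℕ) → Submodule k M) (a : Fin n →₀ ℕ) : ℕ :=
  Module.finrank k (𝓜 a)

/-- The component `M_i = ⨁_{|a| = i} M_a` of the coarse grading. -/
def coarse {k M : Type*} [Field k] {n : ℕ} [AddCommGroup M] [Module k M]
    (𝓜 : (Fin n →₀ ℕ) → Submodule k M) (i : ℕ) : Submodule k M :=
  ⨆ a : {a : Fin n →₀ ℕ // a.degree = i}, 𝓜 a

/-- The (coarse) Hilbert function `i ↦ dim_k M_i`. -/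
def hilbert {k M : Type*} [Field k] {n : ℕ} [AddCommGroup M] [Module k M]
    (𝓜 : (Fin n →₀ ℕ) → Submodule k M) (i : ℕ) : ℕ :=
  Module.finrank k (coarse 𝓜 i)

/-- The Stanley–Reisner ideal, generated by the squarefree monomials of the nonfaces. In
Mathlib's `PreAbstractSimplicialComplex` only the nonempty faces are recorded, and a vertex
need not be a face; the empty set is understood to be a face. -/
def srIdeal (k : Type*) [Field k] {n : ℕ} (Δ : PreAbstractSimplicialComplex (Fin n)) :
    Ideal (MvPolynomial (Fin n) k) :=
  Ideal.span {p | ∃ F : Finset (Fin n), F.Nonempty ∧ F ∉ Δ ∧ p = ∏ i ∈ F, X i}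

/-- The Stanley–Reisner ring `k[Δ] = S / I_Δ`. -/
abbrev SRRing (k : Type*) [Field k] {n : ℕ} (Δ : PreAbstractSimplicialComplex (Fin n)) :=
  MvPolynomial (Fin n) k ⧸ srIdeal k Δ

/-- The `ℕⁿ`-grading of `k[Δ]` induced from `S`. -/
def srGrading (k : Type*) [Field k] {n : ℕ} (Δ : PreAbstractSimplicialComplex (Fin n))
    (a : Fin n →₀ ℕ) : Submodule k (SRRing k Δ) :=
  (polyGrading k n a).map (Ideal.Quotient.mkₐ k (srIdeal k Δ)).toLinearMap

/-- The `ℕⁿ`-grading of the direct sum `k[Δ_1] ⊕ ⋯ ⊕ k[Δ_r]`. -/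
def srSumGrading (k : Type*) [Field k] {n r : ℕ}
    (Δ : Fin r → PreAbstractSimplicialComplex (Fin n)) (a : Fin n →₀ ℕ) :
    Submodule k (∀ j, SRRing k (Δ j)) :=
  Submodule.pi Set.univ fun j => srGrading k (Δ j) a

/-- The set of Hilbert functions of squarefree `S`-modules generated in degree zero. -/
def squarefreeHilbertSet (k : Type u) [Field k] (n : ℕ) : Set (ℕ → ℝ) :=
  {h | ∃ (M : Type u) (_ : AddCommGroup M) (_ : Module k M)
      (_ : Module (MvPolynomial (Fin n) k) M) (_ : IsScalarTower k (MvPolynomial (Fin n) k) M)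
      (𝓜 : (Fin n →₀ ℕ) → Submodule k M),
      IsSquarefree 𝓜 ∧ GeneratedInDegreeZero 𝓜 ∧ h = fun i => (hilbert 𝓜 i : ℝ)}

/-- The set of Hilbert functions of Stanley–Reisner rings over `S`. -/
def srHilbertSet (k : Type*) [Field k] (n : ℕ) : Set (ℕ → ℝ) :=
  {h | ∃ Δ : PreAbstractSimplicialComplex (Fin n), h = fun i => (hilbert (srGrading k Δ) i : ℝ)}

/-- The cone in `ℝ^ℕ` spanned by the Hilbert functions of squarefree `S`-modules generated in
degree zero. -/
def squarefreeCone (k : Type*) [Field k] (n : ℕ) : PointedCone ℝ (ℕ → ℝ) :=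
  PointedCone.hull ℝ (squarefreeHilbertSet k n)

/-- The cone in `ℝ^ℕ` spanned by the Hilbert functions of Stanley–Reisner rings over `S`. -/
def srCone (k : Type*) [Field k] (n : ℕ) : PointedCone ℝ (ℕ → ℝ) :=
  PointedCone.hull ℝ (srHilbertSet k n)

end SquarefreeCone

end

/-!
Let `M` be squarefree and generated in degree zero. Then `M_a = x^a M_0` for every `a`, so
multiplication by a monomial maps `M_a` onto `M_{a+b}` and `dim M_{a+b} ≤ dim M_a`; squarefreeness
turns this into an equality as soon as `supp b ⊆ supp a`. Consequently
`dim M_b = dim M_{a+b} ≤ dim M_a` whenever `supp a ⊆ supp b`: the fine Hilbert function depends only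
on the support and is antitone in it (`fineHilbert_le_of_support_subset`). Finite generation gives
`dim M_0 < ∞` (`finite_component_zero`), so these dimensions are honest.

An antitone function `d` of the support is the sum of the indicator functions of its superlevel
sets `Δ_j = {F | j < d F}`, `j < d ∅`, and these are simplicial complexes
(`exists_complexes_of_antitone`). Since `dim k[Δ]_a` is `1` or `0` according to whether `supp a` is a
face (`fineHilbert_srGrading`), this is the claim about fine Hilbert functions. Summing over the finitely
many exponents of a given degree (`hilbert_eq_sum`) yields the claim about Hilbert functions, and shows
that `H_M` is a sum of Hilbert functions of Stanley–Reisner rings. Conversely every `k[Δ]` is itself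
squarefree and generated in degree zero (`isSquarefree_srGrading`), so that the two cones agree.
-/

namespace SquarefreeCone

open MvPolynomial

/-! ### Families of subspaces -/

section Families

variable {k M ι : Type*} [Field k] [AddCommGroup M] [Module k M]

/-- Independence of a family of subspaces can be certified by linear maps `π a`, where `π a` is
injective on the `a`-th subspace and kills all the others. -/
lemma iSupIndep_of_separating {N : Type*} [AddCommGroup N] [Module k N]
    (𝓜 : ι → Submodule k M) (π : ι → M →ₗ[k] N)
    (hinj : ∀ a, ∀ m ∈ 𝓜 a, π a m = 0 → m = 0)
    (hne : ∀ a b, b ≠ a → ∀ m ∈ 𝓜 b, π a m = 0) : iSupIndep 𝓜 := by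
  rw [iSupIndep_def]
  intro a
  rw [Submodule.disjoint_def]
  intro m hm hm'
  have hle : (⨆ (j) (_ : j ≠ a), 𝓜 j) ≤ LinearMap.ker (π a) :=
    iSup₂_le fun j hj m hm => hne a j hj m hm
  exact hinj a m hm (hle hm')

/-- The projections onto the summands of an internal direct sum. -/
lemma exists_projections [DecidableEq ι] {𝓜 : ι → Submodule k M} (h : DirectSum.IsInternal 𝓜) :
    ∃ π : ι → M →ₗ[k] M, (∀ a, ∀ m ∈ 𝓜 a, π a m = m) ∧
      (∀ a b, b ≠ a → ∀ m ∈ 𝓜 b, π a m = 0) := by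
  let := h.chooseDecomposition
  refine ⟨fun a => (𝓜 a).subtype ∘ₗ DirectSum.component k ι (fun i => 𝓜 i) a ∘ₗ
    (DirectSum.decomposeLinearEquiv 𝓜).toLinearMap, fun a m hm => DirectSum.decompose_of_mem_same 𝓜 hm,
    fun a b hab m hm => DirectSum.decompose_of_mem_ne 𝓜 hm hab⟩

lemma finrank_iSup_of_iSupIndep [Fintype ι] {𝓜 : ι → Submodule k M} (h : iSupIndep 𝓜)
    (hfin : ∀ a, Module.Finite k (𝓜 a)) :
    Module.finrank k (⨆ a, 𝓜 a : Submodule k M) = ∑ a, Module.finrank k (𝓜 a) := by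
  classical
  rw [Submodule.iSup_eq_range_dfinsupp_lsum,
    LinearMap.finrank_range_of_inj h.dfinsupp_lsum_injective]
  exact Module.finrank_directSum k fun a => 𝓜 a

lemma finrank_submodule_pi [Fintype ι] {V : ι → Type*} [∀ j, AddCommGroup (V j)]
    [∀ j, Module k (V j)] (p : ∀ j, Submodule k (V j)) (hfin : ∀ j, Module.Finite k (p j)) :
    Module.finrank k (Submodule.pi Set.univ p) = ∑ j, Module.finrank k (p j) := by
  let e : Submodule.pi Set.univ p ≃ₗ[k] ∀ j, p j :=
    { toFun := fun v j => ⟨v.1 j, v.2 j trivial⟩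
      invFun := fun v => ⟨fun j => v j, fun j _ => (v j).2⟩
      map_add' := fun _ _ => rfl
      map_smul' := fun _ _ => rfl
      left_inv := fun _ => rfl
      right_inv := fun _ => rfl }
  rw [e.finrank_eq, Module.finrank_pi_fintype]

/-- The Hilbert function is obtained from the fine one by summing over all exponents of the given
degree. -/
lemma hilbert_eq_sum {n : ℕ} {𝓜 : (Fin n →₀ ℕ) → Submodule k M} (h : iSupIndep 𝓜)
    (hfin : ∀ a, Module.Finite k (𝓜 a)) (i : ℕ) :
    hilbert 𝓜 i = ∑ a ∈ (Finsupp.finite_of_degree_eq (σ := Fin n) i).toFinset,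
      fineHilbert 𝓜 a := by
  let : Fintype {a : Fin n →₀ ℕ // a.degree = i} :=
    (Finsupp.finite_of_degree_eq (σ := Fin n) i).fintype
  refine (finrank_iSup_of_iSupIndep (h.comp Subtype.val_injective) fun a => hfin a.1).trans ?_
  exact (Finset.sum_subtype _ (fun a => by simp) (fineHilbert 𝓜)).symm

end Families

/-! ### Graded modules generated in degree zero -/

section Graded

variable {k M : Type*} [Field k] {n : ℕ} [AddCommGroup M] [Module k M]
  [Module (MvPolynomial (Fin n) k) M] [IsScalarTower k (MvPolynomial (Fin n) k) M]
  {𝓜 : (Fin n →₀ ℕ) → Submodule k M}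

omit [IsScalarTower k (MvPolynomial (Fin n) k) M] in
lemma IsGraded.monomial_smul_mem (h : IsGraded 𝓜) {a b : Fin n →₀ ℕ} (c : k) {m : M}
    (hm : m ∈ 𝓜 b) : monomial a c • m ∈ 𝓜 (a + b) :=
  h.smul_mem a b _ ⟨c, rfl⟩ m hm

omit [IsScalarTower k (MvPolynomial (Fin n) k) M] in
/-- The component of degree `a` of `c x^b m` is `c x^b` times the component of `m` of degree
`a - b`; the subtraction is truncated, whence the case distinction. -/
lemma projection_monomial_smul (h : IsGraded 𝓜) {π : (Fin n →₀ ℕ) → M →ₗ[k] M}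
    (hπ : ∀ a, ∀ m ∈ 𝓜 a, π a m = m) (hπ' : ∀ a b, b ≠ a → ∀ m ∈ 𝓜 b, π a m = 0)
    (a b : Fin n →₀ ℕ) (c : k) (m : M) :
    π a (monomial b c • m) = if b ≤ a then monomial b c • π (a - b) m else 0 := by
  have hm : m ∈ ⨆ d, 𝓜 d := by
    rw [h.isInternal.submodule_iSup_eq_top]; trivial
  induction hm using Submodule.iSup_induction' with
  | mem d m hm =>
    have hbm := h.monomial_smul_mem (a := b) c hm
    by_cases had : b + d = a
    · subst had
      rw [hπ _ _ hbm, if_pos le_self_add, add_tsub_cancel_left, hπ _ _ hm]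
    · rw [hπ' _ _ had _ hbm]
      split_ifs with hba
      · rw [hπ' (a - b) d _ m hm, smul_zero]
        rintro rfl
        exact had (add_tsub_cancel_of_le hba)
      · rfl
  | zero => simp
  | add x y _ _ hx hy =>
    rw [smul_add, map_add, hx, hy, map_add]
    split_ifs <;> simp

/-- The degree-zero components of a generating set span the component of degree zero. -/
lemma finite_component_zero (h : IsSquarefree 𝓜) : Module.Finite k (𝓜 0) := by
  obtain ⟨π, hπ, hπ'⟩ := exists_projections h.isInternal
  obtain ⟨T, hT⟩ := h.finite.fg_top
  have key : ∀ m : M, π 0 m ∈ Submodule.span k (π 0 '' (T : Set M)) := by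
    intro m
    have hm : m ∈ Submodule.span (MvPolynomial (Fin n) k) (T : Set M) := by
      rw [hT]; trivial
    induction hm using Submodule.span_induction with
    | mem x hx => exact Submodule.subset_span ⟨x, hx, rfl⟩
    | zero => simp
    | add x y _ _ hx hy => rw [map_add]; exact add_mem hx hy
    | smul p x _ hx =>
      induction p using MvPolynomial.induction_on' with
      | monomial b c =>
        rw [projection_monomial_smul h.toIsGraded hπ hπ']
        split_ifs with hb
        · obtain rfl : b = 0 := le_antisymm hb zero_le
          rw [tsub_zero, show monomial (0 : Fin n →₀ ℕ) c = algebraMap k _ c from rfl,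
            algebraMap_smul]
          exact Submodule.smul_mem _ _ hx
        · exact zero_mem _
      | add p q hp hq => rw [add_smul, map_add]; exact add_mem hp hq
  have hle : 𝓜 0 ≤ Submodule.span k (π 0 '' (T : Set M)) := fun m hm => by
    have := key m
    rwa [hπ 0 m hm] at this
  have := FiniteDimensional.span_of_finite k (T.finite_toSet.image (π 0))
  exact Submodule.finiteDimensional_of_le hle

/-- If `M` is generated in degree zero, then `M_a = x^a M_0`. -/
lemma exists_eq_monomial_smul (h : IsGraded 𝓜) (hgen : GeneratedInDegreeZero 𝓜)
    {a : Fin n →₀ ℕ} {m : M} (hm : m ∈ 𝓜 a) :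
    ∃ m₀ ∈ 𝓜 0, m = monomial a (1 : k) • m₀ := by
  obtain ⟨π, hπ, hπ'⟩ := exists_projections h.isInternal
  -- Stated for all components of all elements, the claim is stable under the action of `S`.
  suffices key : ∀ (x : M) (a), ∃ m₀ ∈ 𝓜 0, π a x = monomial a (1 : k) • m₀ by
    simpa only [hπ a m hm] using key m a
  intro x
  have hx : x ∈ Submodule.span (MvPolynomial (Fin n) k) (𝓜 0 : Set M) := by
    rw [show Submodule.span _ _ = ⊤ from hgen]; trivial
  induction hx using Submodule.span_induction with
  | mem x hx =>
    intro a
    by_cases ha : a = 0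
    · subst ha
      exact ⟨x, hx, by rw [hπ 0 x hx]; exact (one_smul (MvPolynomial (Fin n) k) x).symm⟩
    · exact ⟨0, zero_mem _, by rw [hπ' a 0 (Ne.symm ha) x hx, smul_zero]⟩
  | zero => exact fun a => ⟨0, zero_mem _, by simp⟩
  | add x y _ _ hx hy =>
    intro a
    obtain ⟨m, hm, hxm⟩ := hx a
    obtain ⟨m', hm', hym⟩ := hy a
    exact ⟨m + m', add_mem hm hm', by rw [map_add, hxm, hym, smul_add]⟩
  | smul p x _ hx =>
    intro a
    induction p using MvPolynomial.induction_on' with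
    | monomial b c =>
      rw [projection_monomial_smul h hπ hπ']
      split_ifs with hb
      · obtain ⟨m, hm, hxm⟩ := hx (a - b)
        refine ⟨c • m, Submodule.smul_mem _ _ hm, ?_⟩
        rw [hxm, ← algebraMap_smul (MvPolynomial (Fin n) k) c m, smul_smul, smul_smul,
          monomial_mul, add_tsub_cancel_of_le hb, algebraMap_eq, mul_comm _ (C c),
          C_mul_monomial]
      · exact ⟨0, zero_mem _, by simp⟩
    | add p q hp hq =>
      obtain ⟨m, hm, hpm⟩ := hp
      obtain ⟨m', hm', hqm⟩ := hq
      exact ⟨m + m', add_mem hm hm', by rw [add_smul, map_add, hpm, hqm, smul_add]⟩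

/-- Multiplication by `x^b` maps `M_a` onto `M_{b+a}`. -/
lemma map_monomial_component (h : IsGraded 𝓜) (hgen : GeneratedInDegreeZero 𝓜)
    (a b : Fin n →₀ ℕ) :
    (𝓜 a).map (Algebra.lsmul k k M (monomial b (1 : k))) = 𝓜 (b + a) := by
  apply le_antisymm
  · rintro _ ⟨m, hm, rfl⟩
    exact h.monomial_smul_mem 1 hm
  · intro m hm
    obtain ⟨m₀, hm₀, rfl⟩ := exists_eq_monomial_smul h hgen hm
    refine ⟨monomial a (1 : k) • m₀, ?_, ?_⟩
    · simpa using h.monomial_smul_mem (a := a) 1 hm₀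
    · simp [smul_smul, monomial_mul]

lemma finite_component (h : IsSquarefree 𝓜) (hgen : GeneratedInDegreeZero 𝓜)
    (a : Fin n →₀ ℕ) : Module.Finite k (𝓜 a) := by
  have := finite_component_zero h
  rw [← add_zero a, ← map_monomial_component h.toIsGraded hgen]
  infer_instance

lemma fineHilbert_add_le (h : IsSquarefree 𝓜) (hgen : GeneratedInDegreeZero 𝓜)
    (a b : Fin n →₀ ℕ) : fineHilbert 𝓜 (b + a) ≤ fineHilbert 𝓜 a := by
  have := finite_component h hgen a
  rw [fineHilbert, ← map_monomial_component h.toIsGraded hgen]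
  exact Submodule.finrank_map_le _ _

lemma fineHilbert_add_single (h : IsSquarefree 𝓜) {a : Fin n →₀ ℕ} {i : Fin n}
    (hi : i ∈ a.support) : fineHilbert 𝓜 (a + Finsupp.single i 1) = fineHilbert 𝓜 a := by
  have hb := h.bijOn a i hi
  let f : 𝓜 a →ₗ[k] 𝓜 (a + Finsupp.single i 1) :=
    (Algebra.lsmul k k M (X i : MvPolynomial (Fin n) k)).restrict fun m hm => hb.mapsTo hm
  exact (LinearEquiv.ofBijective f hb.bijective).finrank_eq.symm

lemma fineHilbert_add_of_support_subset (h : IsSquarefree 𝓜) {a b : Fin n →₀ ℕ}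
    (hab : a.support ⊆ b.support) : fineHilbert 𝓜 (b + a) = fineHilbert 𝓜 b := by
  induction hd : a.degree generalizing a with
  | zero =>
    rw [(Finsupp.degree_eq_zero_iff a).1 hd, add_zero]
  | succ d ih =>
    obtain ⟨i, hi⟩ : a.support.Nonempty := by
      rw [Finsupp.support_nonempty_iff]
      rintro rfl
      simp at hd
    have hle : Finsupp.single i 1 ≤ a := by
      rw [Finsupp.single_le_iff]
      exact Nat.one_le_iff_ne_zero.2 (Finsupp.mem_support_iff.1 hi)
    obtain ⟨c, rfl⟩ := le_iff_exists_add'.1 hle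
    have hc : c.support ⊆ b.support := (Finsupp.support_mono le_self_add).trans hab
    rw [← add_assoc, fineHilbert_add_single h
      (Finsupp.support_mono (le_self_add : b ≤ b + c) (hab hi))]
    refine ih hc ?_
    simpa using hd

lemma fineHilbert_le_of_support_subset (h : IsSquarefree 𝓜) (hgen : GeneratedInDegreeZero 𝓜)
    {a b : Fin n →₀ ℕ} (hab : a.support ⊆ b.support) :
    fineHilbert 𝓜 b ≤ fineHilbert 𝓜 a := by
  rw [← fineHilbert_add_of_support_subset h hab]
  exact fineHilbert_add_le h hgen a b

end Graded

/-! ### Stanley–Reisner rings -/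

section StanleyReisner

variable (k : Type*) [Field k] {n : ℕ} (Δ : PreAbstractSimplicialComplex (Fin n))

/-- Faces of `Δ`, the empty face included. -/
def IsFace {n : ℕ} (Δ : PreAbstractSimplicialComplex (Fin n)) (F : Finset (Fin n)) : Prop :=
  F = ∅ ∨ F ∈ Δ

variable {k}

/-- `I_Δ` is the monomial ideal spanned by the monomials whose support is not a face. -/
lemma mem_srIdeal_iff {p : MvPolynomial (Fin n) k} :
    p ∈ srIdeal k Δ ↔ ∀ a ∈ p.support, ¬ IsFace Δ a.support := by
  classical
  -- The exponent vector of the squarefree monomial with support `F`.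
  let e : Finset (Fin n) → (Fin n →₀ ℕ) := fun F => ∑ i ∈ F, Finsupp.single i 1
  have he : ∀ F i, e F i = if i ∈ F then 1 else 0 := fun F i => by
    simp [e, Finsupp.finsetSum_apply, Finsupp.single_apply]
  have hle : ∀ F (a : Fin n →₀ ℕ), e F ≤ a ↔ F ⊆ a.support := by
    intro F a
    simp only [Finsupp.le_def, he, Finset.subset_iff, Finsupp.mem_support_iff]
    refine forall_congr' fun i => ?_
    split_ifs with hi <;> simp [hi, Nat.one_le_iff_ne_zero]
  have hset : {p : MvPolynomial (Fin n) k | ∃ F : Finset (Fin n), F.Nonempty ∧ F ∉ Δ ∧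
      p = ∏ i ∈ F, X i} = (fun s => monomial s (1 : k)) '' (e '' {F | F.Nonempty ∧ F ∉ Δ}) := by
    ext p
    simp only [Set.mem_ofPred_eq, Set.mem_image, exists_exists_and_eq_and, e, monomial_sum_one]
    exact exists_congr fun F => by rw [and_assoc, eq_comm]; rfl
  rw [srIdeal, hset, mem_ideal_span_monomial_image]
  refine forall₂_congr fun a _ => ?_
  simp only [Set.mem_image, exists_exists_and_eq_and, hle, Set.mem_ofPred_eq, IsFace, not_or]
  constructor
  · rintro ⟨F, ⟨hF, hFΔ⟩, hFa⟩
    exact ⟨(hF.mono hFa).ne_empty, fun ha => hFΔ ((Δ.isRelLowerSet_faces ha).2 hFa hF)⟩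
  · rintro ⟨h, h'⟩
    exact ⟨a.support, ⟨Finset.nonempty_iff_ne_empty.2 h, h'⟩, subset_rfl⟩

lemma mk_monomial_eq_zero_iff {a : Fin n →₀ ℕ} {c : k} :
    Ideal.Quotient.mk (srIdeal k Δ) (monomial a c) = 0 ↔ c = 0 ∨ ¬ IsFace Δ a.support := by
  classical
  rw [Ideal.Quotient.eq_zero_iff_mem, mem_srIdeal_iff, support_monomial]
  split_ifs with hc <;> simp [hc]

lemma mem_srGrading_iff {a : Fin n →₀ ℕ} {m : SRRing k Δ} :
    m ∈ srGrading k Δ a ↔ ∃ c : k, Ideal.Quotient.mk (srIdeal k Δ) (monomial a c) = m := by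
  constructor
  · rintro ⟨_, ⟨c, rfl⟩, rfl⟩
    exact ⟨c, rfl⟩
  · rintro ⟨c, rfl⟩
    exact ⟨_, ⟨c, rfl⟩, rfl⟩

instance finite_srGrading (a : Fin n →₀ ℕ) : Module.Finite k (srGrading k Δ a) := by
  unfold srGrading polyGrading
  infer_instance

open Classical in
/-- The degree-`a` component of `k[Δ]` is one-dimensional if `supp a` is a face, else zero. -/
lemma fineHilbert_srGrading (a : Fin n →₀ ℕ) :
    fineHilbert (srGrading k Δ) a = if IsFace Δ a.support then 1 else 0 := by
  let f : k →ₗ[k] SRRing k Δ := (Ideal.Quotient.mkₐ k (srIdeal k Δ)).toLinearMap ∘ₗ monomial a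
  have hf : srGrading k Δ a = LinearMap.range f := by
    rw [srGrading, polyGrading, LinearMap.range_comp]
  rw [fineHilbert, hf]
  split_ifs with h
  · rw [LinearMap.finrank_range_of_inj, Module.finrank_self]
    rw [injective_iff_map_eq_zero]
    intro c hc
    exact ((mk_monomial_eq_zero_iff Δ).1 hc).resolve_right (not_not.2 h)
  · have : f = 0 := LinearMap.ext fun c => (mk_monomial_eq_zero_iff Δ).2 (Or.inr h)
    rw [this, LinearMap.range_zero, finrank_bot]

/-- The coefficient of `x^a`, as a functional on `k[Δ]`. It exists if `supp a` is a face; otherwise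
`k[Δ]_a = 0` and the zero functional serves. -/
lemma exists_coeff_functional (a : Fin n →₀ ℕ) :
    ∃ φ : SRRing k Δ →ₗ[k] k, (∀ m ∈ srGrading k Δ a, φ m = 0 → m = 0) ∧
      ∀ b, b ≠ a → ∀ m ∈ srGrading k Δ b, φ m = 0 := by
  classical
  by_cases ha : IsFace Δ a.support
  · let ψ : (MvPolynomial (Fin n) k ⧸ (srIdeal k Δ).restrictScalars k) →ₗ[k] k :=
      ((srIdeal k Δ).restrictScalars k).liftQ (lcoeff k a) fun p hp => by
        by_contra hne
        exact (mem_srIdeal_iff Δ).1 hp a (mem_support_iff.2 hne) ha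
    let φ : SRRing k Δ →ₗ[k] k :=
      ψ ∘ₗ (Submodule.Quotient.restrictScalarsEquiv k (srIdeal k Δ)).symm.toLinearMap
    have hφ : ∀ p, φ (Ideal.Quotient.mk (srIdeal k Δ) p) = coeff a p := fun p => rfl
    refine ⟨φ, fun m hm h0 => ?_, fun b hb m hm => ?_⟩
    · obtain ⟨c, rfl⟩ := (mem_srGrading_iff Δ).1 hm
      rw [hφ, coeff_monomial, if_pos rfl] at h0
      rw [h0, monomial_zero, map_zero]
    · obtain ⟨c, rfl⟩ := (mem_srGrading_iff Δ).1 hm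
      rw [hφ, coeff_monomial, if_neg hb]
  · refine ⟨0, fun m hm _ => ?_, fun _ _ _ _ => rfl⟩
    obtain ⟨c, rfl⟩ := (mem_srGrading_iff Δ).1 hm
    exact (mk_monomial_eq_zero_iff Δ).2 (Or.inr ha)

lemma iSupIndep_srGrading : iSupIndep (srGrading k Δ) := by
  choose φ hφ hφ' using exists_coeff_functional (k := k) Δ
  exact iSupIndep_of_separating _ φ hφ hφ'

lemma isSquarefree_srGrading : IsSquarefree (srGrading k Δ) where
  isInternal := by
    refine DirectSum.isInternal_submodule_of_iSupIndep_of_iSup_eq_top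
      (iSupIndep_srGrading Δ) (eq_top_iff.2 ?_)
    intro m _
    obtain ⟨p, rfl⟩ := Ideal.Quotient.mk_surjective m
    induction p using MvPolynomial.induction_on' with
    | monomial a c =>
      exact Submodule.mem_iSup_of_mem a ((mem_srGrading_iff Δ).2 ⟨c, rfl⟩)
    | add p q hp hq =>
      rw [map_add]
      exact add_mem (hp trivial) (hq trivial)
  smul_mem := by
    rintro a b _ ⟨c, rfl⟩ m hm
    obtain ⟨d, rfl⟩ := (mem_srGrading_iff Δ).1 hm
    refine (mem_srGrading_iff Δ).2 ⟨c * d, ?_⟩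
    rw [← monomial_mul, map_mul]
    rfl
  finite := inferInstance
  bijOn := by
    intro a i hi
    have hsmul : ∀ c : k, (X i : MvPolynomial (Fin n) k) •
        Ideal.Quotient.mk (srIdeal k Δ) (monomial a c) =
        Ideal.Quotient.mk (srIdeal k Δ) (monomial (a + Finsupp.single i 1) c) := by
      intro c
      rw [add_comm, monomial_single_add, pow_one, map_mul]
      rfl
    -- Multiplication by `x_i` does not enlarge the support, hence does not leave the faces.
    have hsupp : (a + Finsupp.single i 1).support = a.support := by
      ext j
      rw [Finsupp.mem_support_iff] at hi
      by_cases hj : j = i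
      · subst hj; simp [hi]
      · simp [Ne.symm hj]
    refine ⟨?_, ?_, ?_⟩
    · intro m hm
      obtain ⟨c, rfl⟩ := (mem_srGrading_iff Δ).1 hm
      exact (mem_srGrading_iff Δ).2 ⟨c, (hsmul c).symm⟩
    · intro m hm m' hm' heq
      obtain ⟨c, rfl⟩ := (mem_srGrading_iff Δ).1 hm
      obtain ⟨c', rfl⟩ := (mem_srGrading_iff Δ).1 hm'
      simp only [hsmul] at heq
      rw [← sub_eq_zero, ← map_sub, ← map_sub, mk_monomial_eq_zero_iff] at heq ⊢
      rwa [hsupp] at heq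
    · intro m hm
      obtain ⟨c, rfl⟩ := (mem_srGrading_iff Δ).1 hm
      exact ⟨_, (mem_srGrading_iff Δ).2 ⟨c, rfl⟩, hsmul c⟩

lemma generatedInDegreeZero_srGrading : GeneratedInDegreeZero (srGrading k Δ) := by
  refine eq_top_iff.2 fun m _ => ?_
  obtain ⟨p, rfl⟩ := Ideal.Quotient.mk_surjective m
  have h1 : (Ideal.Quotient.mk (srIdeal k Δ) 1) ∈ srGrading k Δ 0 :=
    (mem_srGrading_iff Δ).2 ⟨1, rfl⟩
  have := Submodule.smul_mem _ p (Submodule.subset_span (R := MvPolynomial (Fin n) k) h1)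
  convert this using 1
  rw [← mul_one p, map_mul, mul_one]
  rfl

variable {r : ℕ} (Γ : Fin r → PreAbstractSimplicialComplex (Fin n))

instance finite_srSumGrading (a : Fin n →₀ ℕ) : Module.Finite k (srSumGrading k Γ a) :=
  Module.Finite.iff_fg.2 (Submodule.fg_pi fun _ => Module.Finite.iff_fg.1 inferInstance)

lemma fineHilbert_srSumGrading (a : Fin n →₀ ℕ) :
    fineHilbert (srSumGrading k Γ) a = ∑ j, fineHilbert (srGrading k (Γ j)) a :=
  finrank_submodule_pi _ fun _ => inferInstance

lemma iSupIndep_srSumGrading : iSupIndep (srSumGrading k Γ) := by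
  choose φ hφ hφ' using fun j => exists_coeff_functional (k := k) (Γ j)
  refine iSupIndep_of_separating _
    (fun a => LinearMap.pi fun j => φ j a ∘ₗ LinearMap.proj j) ?_ ?_
  · intro a m hm h0
    funext j
    exact hφ j a (m j) (hm j trivial) (congrFun h0 j)
  · intro a b hab m hm
    funext j
    exact hφ' j a b hab (m j) (hm j trivial)

lemma hilbert_srSumGrading (i : ℕ) :
    hilbert (srSumGrading k Γ) i = ∑ j, hilbert (srGrading k (Γ j)) i := by
  rw [hilbert_eq_sum (iSupIndep_srSumGrading Γ) (finite_srSumGrading Γ)]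
  simp_rw [hilbert_eq_sum (iSupIndep_srGrading _) (finite_srGrading _),
    fineHilbert_srSumGrading]
  exact Finset.sum_comm

end StanleyReisner

/-! ### Decomposition of antitone functions -/

open Classical in
/-- A function of exponents that is antitone in the support is the sum of the indicator functions of
its superlevel sets, which are simplicial complexes. -/
lemma exists_complexes_of_antitone {n : ℕ} (d : (Fin n →₀ ℕ) → ℕ)
    (hd : ∀ a b : Fin n →₀ ℕ, a.support ⊆ b.support → d b ≤ d a) :
    ∃ Δ : Fin (d 0) → PreAbstractSimplicialComplex (Fin n),
      ∀ a, d a = ∑ j, if IsFace (Δ j) a.support then 1 else 0 := by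
  let Δ : Fin (d 0) → PreAbstractSimplicialComplex (Fin n) := fun j =>
    { faces := {F | F.Nonempty ∧ ∃ a : Fin n →₀ ℕ, a.support = F ∧ j < d a}
      isRelLowerSet_faces := by
        rintro _ ⟨hF, a, rfl, ha⟩
        refine ⟨hF, fun G hG hG' => ⟨hG', a.filter (· ∈ G), ?_, ha.trans_le (hd _ _ ?_)⟩⟩
        · rw [Finsupp.support_filter, Finset.filter_mem_eq_inter]
          exact Finset.inter_eq_right.2 hG
        · rw [Finsupp.support_filter]
          exact Finset.filter_subset _ _ }
  refine ⟨Δ, fun a => ?_⟩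
  have hface : ∀ j, IsFace (Δ j) a.support ↔ (j : ℕ) < d a := by
    intro j
    constructor
    · rintro (h | ⟨_, b, hb, hj⟩)
      · rw [Finsupp.support_eq_empty.1 h]
        exact j.2
      · exact hj.trans_le (hd _ _ hb.ge)
    · intro hj
      rcases a.support.eq_empty_or_nonempty with h | h
      · exact Or.inl h
      · exact Or.inr ⟨h, a, rfl, hj⟩
  simp_rw [hface]
  rw [Finset.sum_boole, Fin.card_filter_val_lt, Nat.cast_id]
  exact (min_eq_right (hd 0 a (by simp))).symm

/-- The complexes are the superlevel sets of the fine Hilbert function; the Hilbert functions agree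
because the fine ones do and both families of components are independent. -/
lemma exists_complexes_fineHilbert {k M : Type*} [Field k] {n : ℕ} [AddCommGroup M] [Module k M]
    [Module (MvPolynomial (Fin n) k) M] [IsScalarTower k (MvPolynomial (Fin n) k) M]
    {𝓜 : (Fin n →₀ ℕ) → Submodule k M} (h : IsSquarefree 𝓜) (hgen : GeneratedInDegreeZero 𝓜) :
    ∃ (r : ℕ) (Δ : Fin r → PreAbstractSimplicialComplex (Fin n)),
      fineHilbert 𝓜 = fineHilbert (srSumGrading k Δ) ∧
      hilbert 𝓜 = hilbert (srSumGrading k Δ) := by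
  classical
  obtain ⟨Δ, hΔ⟩ := exists_complexes_of_antitone (fineHilbert 𝓜)
    fun a b hab => fineHilbert_le_of_support_subset h hgen hab
  have hfine : fineHilbert 𝓜 = fineHilbert (srSumGrading k Δ) := by
    funext a
    rw [hΔ, fineHilbert_srSumGrading]
    simp_rw [fineHilbert_srGrading]
  refine ⟨_, Δ, hfine, funext fun i => ?_⟩
  rw [hilbert_eq_sum h.isInternal.submodule_iSupIndep (finite_component h hgen),
    hilbert_eq_sum (iSupIndep_srSumGrading Δ) (finite_srSumGrading Δ)]
  exact Finset.sum_congr rfl fun a _ => congrFun hfine a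

end SquarefreeCone

theorem mainTheorem7 (k : Type u) [Field k] (n : ℕ) :
    (∀ (M : Type*) [AddCommGroup M] [Module k M] [Module (MvPolynomial (Fin n) k) M]
      [IsScalarTower k (MvPolynomial (Fin n) k) M] (𝓜 : (Fin n →₀ ℕ) → Submodule k M),
      SquarefreeCone.IsSquarefree 𝓜 → SquarefreeCone.GeneratedInDegreeZero 𝓜 →
      ∃ (r : ℕ) (Δ : Fin r → PreAbstractSimplicialComplex (Fin n)),
        SquarefreeCone.fineHilbert 𝓜 =
          SquarefreeCone.fineHilbert (SquarefreeCone.srSumGrading k Δ) ∧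
        SquarefreeCone.hilbert 𝓜 =
          SquarefreeCone.hilbert (SquarefreeCone.srSumGrading k Δ)) ∧
    SquarefreeCone.squarefreeCone k n = SquarefreeCone.srCone k n := by
  refine ⟨fun M _ _ _ _ 𝓜 h hgen => SquarefreeCone.exists_complexes_fineHilbert h hgen,
    le_antisymm ?_ ?_⟩
  · refine Submodule.span_le.2 ?_
    rintro _ ⟨M, _, _, _, _, 𝓜, h, hgen, rfl⟩
    obtain ⟨r, Δ, -, hΔ⟩ := SquarefreeCone.exists_complexes_fineHilbert h hgen
    have hsum : (fun i => (SquarefreeCone.hilbert 𝓜 i : ℝ)) =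
        ∑ j, fun i => (SquarefreeCone.hilbert (SquarefreeCone.srGrading k (Δ j)) i : ℝ) := by
      funext i
      rw [hΔ, SquarefreeCone.hilbert_srSumGrading, Finset.sum_apply, Nat.cast_sum]
    rw [hsum]
    exact Submodule.sum_mem _ fun j _ => Submodule.subset_span ⟨Δ j, rfl⟩
  · refine Submodule.span_mono ?_
    rintro _ ⟨Δ, rfl⟩
    exact ⟨SquarefreeCone.SRRing k Δ, inferInstance, inferInstance, inferInstance, inferInstance,
      SquarefreeCone.srGrading k Δ, SquarefreeCone.isSquarefree_srGrading Δ,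
      SquarefreeCone.generatedInDegreeZero_srGrading Δ, rfl⟩
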